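/- Let $k$ be an algebraically closed field of characteristic $p\ge 0$. For a composition $\gamma=(\gamma_1,\dots,\gamma_t)$ of $d$ into nonnegative parts let $\Sigma_\gamma=\Sigma_{\gamma_1}\times\cdots\times\Sigma_{\gamma_t}\subseteq\Sigma_d$ be the Young subgroup. For sequences of nonnegative integers $\lambda=(\lambda_1,\dots,\lambda_m)$ and $\mu=(\mu_1,\dots,\mu_n)$ of total sum $d$, the signed permutation module is $M^{(\lambda|\mu)}=\operatorname{ind}_{\Sigma_\lambda\times\Sigma_\mu}^{\Sigma_d}(k\boxtimes\operatorname{sgn})$, where $k$ is the trivial module of $\Sigma_\lambda$ and $\operatorname{sgn}$ is the sign representation of $\Sigma_\mu$. A $k\Sigma_d$-module is a signed Young module for $m,n$ if it is isomorphic to a direct summand of $M^{(\lambda|\mu)}$ for some such $(\lambda|\mu)$, with $\lambda$ of length $m$ and $\mu$ of length $n$. For a partition $\lambda$ of $d$, the Young module $Y^\lambda$ is the indecomposable direct summand, unique up to isomorphism, of the permutation module $M^\lambda=\operatorname{ind}_{\Sigma_\lambda}^{\Sigma_d}k$ that contains the Specht module $S^\lambda\subseteq M^\lambda$. Let $a\ge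 b\ge 1$ and $1\le c<p$ be integers, and let $d=a+b+c$. Then the Young module $Y^{(a,b,1^c)}$ is isomorphic to a direct summand of the signed permutation module $M^{(a,b|c)}$. In particular, $Y^{(a,b,1^c)}$ is a signed Young module for $m=2$, $n=1$. -/

import Mathlib

namespace SignedYoung

open Equiv

/-! ### Direct summands and indecomposable representations -/

section General

variable {k G V W : Type*} [Field k] [Group G] [AddCommGroup V] [Module k V]
  [AddCommGroup W] [Module k W]

/-- `ρ` is (isomorphic to) a direct summand of `σ`: there is an internal direct sum decomposition
`σ = U ⊕ U'` into subrepresentations with `ρ ≅ U`. -/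
def IsDirectSummand (ρ : Representation k G V) (σ : Representation k G W) : Prop :=
  ∃ U U' : Subrepresentation σ, IsCompl U.toSubmodule U'.toSubmodule ∧
    Nonempty (ρ.Equiv U.toRepresentation)

/-- `ρ` is indecomposable: it is nonzero, and in every decomposition `ρ = U ⊕ U'` into
subrepresentations one of the two summands is zero. -/
def IsIndecomposable (ρ : Representation k G V) : Prop :=
  Nontrivial V ∧ ∀ U U' : Subrepresentation ρ, IsCompl U.toSubmodule U'.toSubmodule →
    U.toSubmodule = ⊥ ∨ U'.toSubmodule = ⊥

end General

/-! ### Compositions and Young subgroups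

A composition is a list `γ = [γ₁, …, γₜ]` of nonnegative integers. The letters are
`0, 1, …, d - 1`. The first `γ₁` letters form row `0`, the next `γ₂` letters row `1`, and so on,
so that the letters fill the diagram of `γ` row by row, from left to right. -/

/-- The (0-based) row of the diagram of `γ` that contains the letter `x`. -/
def row : List ℕ → ℕ → ℕ
  | [], _ => 0
  | g :: γ, x => if x < g then 0 else row γ (x - g) + 1

/-- The (0-based) column of the diagram of `γ` that contains the letter `x`. -/
def col : List ℕ → ℕ → ℕ
  | [], x => x
  | g :: γ, x => if x < g then x else col γ (x - g)

/-- The Young subgroup `Σ_γ = Σ_{γ₁} × ⋯ × Σ_{γₜ}` of `Σ_d` for `γ` of sum `d`: the first factor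
permutes the first `γ₁` letters, the second one the next `γ₂` letters, and so on. -/
def youngSubgroup (d : ℕ) (γ : List ℕ) : Subgroup (Perm (Fin d)) where
  carrier := {g | ∀ x : Fin d, row γ (g x) = row γ x}
  one_mem' _ := rfl
  mul_mem' {g h} hg hh x := (hg (h x)).trans (hh x)
  inv_mem' {g} hg x := by simpa using (hg (g⁻¹ x)).symm

/-- The column stabilizer of the tableau of shape `γ` that is filled row by row. -/
def columnStabilizer (d : ℕ) (γ : List ℕ) : Subgroup (Perm (Fin d)) where
  carrier := {g | ∀ x : Fin d, col γ (g x) = col γ x}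
  one_mem' _ := rfl
  mul_mem' {g h} hg hh x := (hg (h x)).trans (hh x)
  inv_mem' {g} hg x := by simpa using (hg (g⁻¹ x)).symm

/-! ### Signed permutation modules and signed Young modules -/

section Signed

variable (k : Type*) [Field k] (d : ℕ) (lam mu : List ℕ)

/-- The character of `Σ_λ × Σ_μ` that is trivial on `Σ_λ` and the sign on `Σ_μ`: the sign of the
permutation induced on the letters in the rows that belong to `μ`. -/
def signCharacter : youngSubgroup d (lam ++ mu) →* ℤˣ where
  toFun g := Perm.sign (Perm.subtypePerm (p := fun x : Fin d => lam.length ≤ row (lam ++ mu) x)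
    g.1 fun x => by rw [g.2 x])
  map_one' := Perm.sign_one
  map_mul' g h := by
    rw [← Perm.sign_mul]
    rfl

/-- The one-dimensional representation `k ⊠ sgn` of `Σ_λ × Σ_μ`. -/
def trivialTensorSign : Representation k (youngSubgroup d (lam ++ mu)) k where
  toFun g := (((signCharacter d lam mu g : ℤˣ) : ℤ) : k) • LinearMap.id
  map_one' := by
    ext
    simp
  map_mul' g h := by
    ext
    simp [mul_comm]

/-- The signed permutation module `M^(λ|μ)`, the module induced from `k ⊠ sgn` on `Σ_λ × Σ_μ` to
`Σ_d`, for `(λ|μ)` of total sum `d`. -/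
noncomputable def signedPermutationModule :=
  Representation.ind (youngSubgroup d (lam ++ mu)).subtype (trivialTensorSign k d lam mu)

/-- The set `Λ(m|n,d)` of the pairs `(λ|μ)`, where `λ` is a sequence of `m` and `μ` a sequence of
`n` nonnegative integers, with total sum `d`. -/
def weights (m n d : ℕ) : Set (List ℕ × List ℕ) :=
  {w | w.1.length = m ∧ w.2.length = n ∧ w.1.sum + w.2.sum = d}

variable {k d} in
/-- `ρ` is a signed Young module for `m` and `n`: a direct summand of `M^(λ|μ)` for some
`(λ|μ) ∈ Λ(m|n,d)`. -/
def IsSignedYoungModule (m n : ℕ) {V : Type*} [AddCommGroup V] [Module k V]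
    (ρ : Representation k (Perm (Fin d)) V) : Prop :=
  ∃ w ∈ weights m n d, IsDirectSummand ρ (signedPermutationModule k d w.1 w.2)

end Signed

/-! ### Permutation modules, Specht modules and Young modules -/

section Young

variable (k : Type*) [Field k] (d : ℕ) (lam : List ℕ)

/-- The underlying vector space of the permutation module `M^λ`. -/
abbrev PermutationModule :=
  Representation.IndV (youngSubgroup d lam).subtype
    (Representation.trivial k (youngSubgroup d lam) k)

/-- The permutation module `M^λ`, the module induced from the trivial module of `Σ_λ` to `Σ_d`. -/
noncomputable def permutationModule :
    Representation k (Perm (Fin d)) (PermutationModule k d lam) :=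
  Representation.ind (youngSubgroup d lam).subtype
    (Representation.trivial k (youngSubgroup d lam) k)

/-- The canonical generator `1 ⊗ 1` of `M^λ`, that is, the tabloid `{t}` of the tableau `t` of
shape `λ` that is filled row by row; its stabilizer is `Σ_λ`, and the tabloid of `g t` is
`g • {t}`. -/
noncomputable def tabloid : PermutationModule k d lam :=
  Representation.IndV.mk (youngSubgroup d lam).subtype
    (Representation.trivial k (youngSubgroup d lam) k) 1 1

open scoped Classical in
/-- The polytabloid `e_t = ∑ sgn(g) g • {t}`, with `g` running over the column stabilizer of `t`,
where `t` is the tableau of shape `λ` that is filled row by row. -/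
noncomputable def polytabloid : PermutationModule k d lam :=
  ∑ g : columnStabilizer d lam,
    ((Perm.sign (g : Perm (Fin d)) : ℤ) : k) • permutationModule k d lam g (tabloid k d lam)

/-- The Specht module `S^λ ⊆ M^λ`: the span of all polytabloids `e_{g t} = g • e_t`. -/
noncomputable def spechtModule : Submodule k (PermutationModule k d lam) :=
  Submodule.span k
    (Set.range fun g : Perm (Fin d) => permutationModule k d lam g (polytabloid k d lam))

variable {k d} in
/-- `Y` is the Young module `Y^λ` of the partition `λ` of `d` (which is unique up to isomorphism):
it is indecomposable and isomorphic to a direct summand of `M^λ` that contains the Specht module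
`S^λ`. -/
def IsYoungModule {V : Type*} [AddCommGroup V] [Module k V]
    (Y : Representation k (Perm (Fin d)) V) : Prop :=
  IsIndecomposable Y ∧
    ∃ U U' : Subrepresentation (permutationModule k d lam),
      IsCompl U.toSubmodule U'.toSubmodule ∧ spechtModule k d lam ≤ U.toSubmodule ∧
        Nonempty (Y.Equiv U.toRepresentation)

end Young

end SignedYoung

/-! Homomorphisms `f : M^(a,b,1^c) → M^(a,b|c)` and `g` back come from Frobenius reciprocity: `f`
matches the canonical generators, and `g` sends the generator to the signed sum of the tabloids
obtained by permuting the last `c` letters. These letters all lie in the first column, so the signed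
column sum defining the polytabloid `e_t` absorbs each such permutation together with its sign.
Hence `g (f e_t) = c! • e_t` (`ofSigned_toSigned_polytabloid`), and `c!` is nonzero in `k` because
`c < p`.

The polytabloid is nonzero and lies in the Specht module, hence in the Young module. So an
endomorphism of this indecomposable module that factors through `M^(a,b|c)` has a nonzero
eigenvalue. By Fitting's lemma it is bijective, which splits the Young module off `M^(a,b|c)`
(`isDirectSummand_of_eigenvector`). -/

namespace SignedYoung

/-! ### Fitting's lemma and splitting off indecomposable summands -/

section General

variable {k G V W : Type*} [Field k] [Group G] [AddCommGroup V] [Module k V]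
  [AddCommGroup W] [Module k W]

/-- By Fitting's lemma, an indecomposable representation is a direct summand of every
representation through which an endomorphism with a nonzero eigenvalue factors. -/
theorem IsIndecomposable.isDirectSummand [FiniteDimensional k V] {ρ : Representation k G V}
    {σ : Representation k G W} (hρ : IsIndecomposable ρ) (f : ρ.IntertwiningMap σ)
    (g : σ.IntertwiningMap ρ) {v : V} (hv : v ≠ 0) {r : k} (hr : r ≠ 0)
    (h : g (f v) = r • v) : IsDirectSummand ρ σ := by
  let e : Module.End k V := g.toLinearMap ∘ₗ f.toLinearMap
  have he (x : V) : e x = g (f x) := rfl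
  have hcomm (s : G) (n : ℕ) (x : V) : (e ^ n) (ρ s x) = ρ s ((e ^ n) x) := by
    have h1 : Commute e (ρ s) := LinearMap.ext fun y => by
      simp [he, f.isIntertwining, g.isIntertwining]
    exact LinearMap.congr_fun (h1.pow_left n).eq x
  have hev (n : ℕ) : (e ^ n) v = r ^ n • v := by
    induction n with
    | zero => simp
    | succ n ih => rw [pow_succ, Module.End.mul_apply, he, h, map_smul, ih, smul_smul, pow_succ']
  -- Fitting decomposition for large `n`; `n ≥ 1` is needed to pass from injectivity of `e ^ n` to
  -- that of `e`.
  obtain ⟨n, hn, hn1⟩ := (e.eventually_isCompl_ker_pow_range_pow.and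
    (Filter.eventually_ge_atTop 1)).exists
  let K : Subrepresentation ρ := ⟨LinearMap.ker (e ^ n), fun s x hx => by
    rw [LinearMap.mem_ker] at hx ⊢
    rw [hcomm, hx, map_zero]⟩
  let R : Subrepresentation ρ := ⟨LinearMap.range (e ^ n), by
    rintro s _ ⟨x, rfl⟩
    exact ⟨ρ s x, hcomm s n x⟩⟩
  have hinj : Function.Injective e := by
    rcases hρ.2 K R hn with hK | hR
    · have : Function.Injective (e ^ n) := LinearMap.ker_eq_bot.1 hK
      obtain ⟨m, rfl⟩ := Nat.exists_eq_add_of_le' hn1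
      rw [pow_succ, Module.End.mul_eq_comp, LinearMap.coe_comp] at this
      exact this.of_comp
    -- The range cannot vanish: it contains `r ^ n • v ≠ 0`.
    · have hmem : (e ^ n) v ∈ (⊥ : Submodule k V) := hR ▸ LinearMap.mem_range_self (e ^ n) v
      rw [hev, Submodule.mem_bot] at hmem
      exact absurd hmem (smul_ne_zero (pow_ne_zero n hr) hv)
  have hsurj : Function.Surjective e := LinearMap.injective_iff_surjective.1 hinj
  -- Since `g ∘ f` is bijective, `f` embeds `ρ` and the kernel of `g` is a complement of the image.
  refine ⟨f.range, g.ker, ⟨?_, ?_⟩, ?_⟩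
  · rw [Submodule.disjoint_def]
    rintro _ ⟨x, rfl⟩ hx
    have : x = 0 := hinj (hx.trans (map_zero e).symm)
    rw [this, map_zero]
  · rw [codisjoint_iff_le_sup]
    intro y _
    obtain ⟨x, hx⟩ := hsurj (g y)
    refine Submodule.mem_sup.2 ⟨f x, ⟨x, rfl⟩, y - f x, ?_, by abel⟩
    change g (y - f x) = 0
    rw [map_sub, ← hx, he, sub_self]
  · have hfinj : Function.Injective f.toLinearMap := fun x y hxy => hinj (congrArg g hxy)
    exact ⟨.mk (LinearEquiv.ofInjective f.toLinearMap hfinj) fun s =>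
      LinearMap.ext fun x => Subtype.ext (f.isIntertwining _ _ s x)⟩

/-- The inclusion of a subrepresentation. -/
def subrepresentationInclusion {ρ : Representation k G V} (U : Subrepresentation ρ) :
    U.toRepresentation.IntertwiningMap ρ where
  toLinearMap := U.toSubmodule.subtype
  isIntertwining' _ := rfl

/-- The projection to a subrepresentation along a complementary one. -/
noncomputable def subrepresentationProjection {ρ : Representation k G V}
    (U U' : Subrepresentation ρ) (h : IsCompl U.toSubmodule U'.toSubmodule) :
    ρ.IntertwiningMap U.toRepresentation where
  toLinearMap := Submodule.projectionOnto U.toSubmodule U'.toSubmodule h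
  isIntertwining' s := by
    ext x
    obtain ⟨u, hu, w, hw, rfl⟩ :=
      Submodule.mem_sup.1 (h.sup_eq_top ▸ Submodule.mem_top : x ∈ U.toSubmodule ⊔ U'.toSubmodule)
    have h1 := Submodule.projectionOnto_apply_left h ⟨u, hu⟩
    have h2 := Submodule.projectionOnto_apply_left h ⟨ρ s u, U.apply_mem_toSubmodule s hu⟩
    have h3 := Submodule.projectionOnto_apply_right h ⟨w, hw⟩
    have h4 := Submodule.projectionOnto_apply_right h ⟨ρ s w, U'.apply_mem_toSubmodule s hw⟩
    simp only [LinearMap.comp_apply, map_add] at *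
    rw [h1, h2, h3, h4]
    simp [Subrepresentation.toRepresentation]

/-- An indecomposable direct summand of `σ` that contains an eigenvector, with nonzero eigenvalue,
of an endomorphism of `σ` factoring through `τ` is a direct summand of `τ`. -/
theorem isDirectSummand_of_eigenvector {X : Type*} [AddCommGroup X] [Module k X]
    [FiniteDimensional k W] {ρ : Representation k G V} {σ : Representation k G W}
    {τ : Representation k G X} (hρ : IsIndecomposable ρ) {U U' : Subrepresentation σ}
    (hU : IsCompl U.toSubmodule U'.toSubmodule) (e : ρ.Equiv U.toRepresentation)
    (f : σ.IntertwiningMap τ) (g : τ.IntertwiningMap σ) {w : W} (hwU : w ∈ U.toSubmodule)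
    (hw : w ≠ 0) {r : k} (hr : r ≠ 0) (h : g (f w) = r • w) : IsDirectSummand ρ τ := by
  have : FiniteDimensional k V := LinearEquiv.finiteDimensional e.toLinearEquiv.symm
  let π := subrepresentationProjection U U' hU
  have hproj : π w = ⟨w, hwU⟩ := Submodule.projectionOnto_apply_left hU ⟨w, hwU⟩
  have hincl : subrepresentationInclusion U ⟨w, hwU⟩ = w := rfl
  -- The endomorphism is `ρ ≅ U ⊆ σ → τ → σ → U ≅ ρ`; the projection fixes `w`, so the eigenvalue
  -- `r` survives.
  refine hρ.isDirectSummand (v := e.symm ⟨w, hwU⟩)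
    (f.comp ((subrepresentationInclusion U).comp e.toIntertwiningMap))
    (e.symm.toIntertwiningMap.comp (π.comp g)) ?_ hr ?_
  · intro h0
    have := congrArg e h0
    rw [e.apply_symm_apply, map_zero] at this
    exact hw (congrArg Subtype.val this)
  · have h1 : e.toIntertwiningMap (e.symm ⟨w, hwU⟩) = ⟨w, hwU⟩ := e.apply_symm_apply _
    have h2 (y) : e.symm.toIntertwiningMap y = e.symm y := rfl
    simp only [Representation.IntertwiningMap.comp_apply, h1, h2, hincl, h, map_smul, hproj]

end General

/-! ### Induced representations and Frobenius reciprocity -/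

section Induced

variable {k G H A B : Type*} [CommRing k] [Group G] [Group H] (φ : G →* H) [AddCommGroup A]
  [Module k A] (ρ : Representation k G A) [AddCommGroup B] [Module k B]

/-- Frobenius reciprocity: the homomorphism from an induced representation that extends a
homomorphism to a restricted representation. -/
noncomputable def indLift (σ : Representation k H B) (f : A →ₗ[k] B)
    (hf : ∀ g x, f (ρ g x) = σ (φ g) (f x)) : (ρ.ind φ).IntertwiningMap σ where
  toLinearMap := Representation.Coinvariants.lift _
    -- The inverse reflects the convention that `s` acts by `h ↦ h * s⁻¹`, so that `h ⊗ x` is `h⁻¹`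
    -- applied to `1 ⊗ x`.
    (TensorProduct.lift <| (Finsupp.lift _ _ _ fun h => σ h⁻¹ ∘ₗ f) ∘ₗ
      (MonoidAlgebra.coeffLinearEquiv k).toLinearMap)
    fun g ↦ by
      ext h x
      simp only [LinearMap.coe_comp, Function.comp_apply, MonoidAlgebra.lsingle_apply]
      simp [Representation.ofMulAction_single, mul_inv_rev, hf]
  isIntertwining' g := by ext; simp

theorem indLift_mk (σ : Representation k H B) (f : A →ₗ[k] B)
    (hf : ∀ g x, f (ρ g x) = σ (φ g) (f x)) (h : H) (x : A) :
    indLift φ ρ σ f hf (Representation.IndV.mk φ ρ h x) = σ h⁻¹ (f x) := by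
  change (indLift φ ρ σ f hf).toLinearMap _ = _
  simp [indLift]

theorem ind_apply_mk_one (g : G) (x : A) :
    ρ.ind φ (φ g) (Representation.IndV.mk φ ρ 1 x) = Representation.IndV.mk φ ρ 1 (ρ g x) := by
  rw [Representation.ind_mk, one_mul]
  have := Representation.Coinvariants.mk_inv_tmul ((Representation.leftRegular k H).comp φ) ρ
    (.single 1 1) x g
  simpa [Representation.ofMulAction_single] using this

instance [Finite H] [Module.Finite k A] : Module.Finite k (Representation.IndV φ ρ) := by
  have : Module.Finite k (MonoidAlgebra k H) :=
    Module.Finite.equiv (MonoidAlgebra.coeffLinearEquiv k).symm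
  infer_instance

end Induced

end SignedYoung


namespace SignedYoung

open Equiv

/-! ### Rows and columns of the diagrams of `(a,b,1^c)` and `(a,b,c)` -/

section Tableaux

theorem eq_of_row_eq_of_col_eq (γ : List ℕ) {x y : ℕ} (hr : row γ x = row γ y)
    (hc : col γ x = col γ y) : x = y := by
  induction γ generalizing x y with
  | nil => exact hc
  | cons g γ ih =>
    simp only [row, col] at hr hc
    split_ifs at hr hc with h1 h2
    · exact hc
    · have := ih (Nat.succ_injective hr) hc
      omega

theorem row_replicate_one {c x : ℕ} (h : x < c) : row (List.replicate c 1) x = x := by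
  induction c generalizing x with
  | zero => omega
  | succ c ih =>
    rw [List.replicate_succ, row]
    split_ifs with h1
    · omega
    · rw [ih (by omega)]
      omega

theorem col_replicate_one {c x : ℕ} (h : x < c) : col (List.replicate c 1) x = 0 := by
  induction c generalizing x with
  | zero => omega
  | succ c ih =>
    rw [List.replicate_succ, col]
    split_ifs with h1
    · omega
    · exact ih (by omega)

variable {a b c : ℕ}

theorem row_cons_cons_replicate_one {x : ℕ} (h : x < a + b + c) :
    row (a :: b :: List.replicate c 1) x =
      if x < a then 0 else if x < a + b then 1 else x - (a + b) + 2 := by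
  simp only [row]
  split_ifs with h1 h2 h3 h4 <;> try omega
  rw [row_replicate_one (by omega)]
  omega

theorem col_cons_cons_replicate_one {x : ℕ} (h : x < a + b + c) (hx : a + b ≤ x) :
    col (a :: b :: List.replicate c 1) x = 0 := by
  simp only [col]
  rw [if_neg (by omega), if_neg (by omega), col_replicate_one (by omega)]

theorem row_append_singleton {x : ℕ} (h : x < a + b + c) :
    row ([a, b] ++ [c]) x = if x < a then 0 else if x < a + b then 1 else 2 := by
  simp only [List.cons_append, List.nil_append, row]
  split_ifs <;> omega

theorem two_le_row_append_singleton {x : ℕ} (h : x < a + b + c) :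
    2 ≤ row ([a, b] ++ [c]) x ↔ a + b ≤ x := by
  rw [row_append_singleton h]
  split_ifs <;> omega

/-- Each of the last `c` letters is alone in its row of `(a,b,1^c)`, so preserving rows pins it. -/
theorem mem_youngSubgroup_cons_cons_replicate_one {g : Perm (Fin (a + b + c))} :
    g ∈ youngSubgroup (a + b + c) (a :: b :: List.replicate c 1) ↔
      g ∈ youngSubgroup (a + b + c) ([a, b] ++ [c]) ∧
        ∀ x : Fin (a + b + c), a + b ≤ x → g x = x := by
  constructor
  · intro hg
    refine ⟨fun x => ?_, fun x hx => Fin.ext ?_⟩ <;>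
    · have h := hg x
      rw [row_cons_cons_replicate_one x.2, row_cons_cons_replicate_one (g x).2] at h
      try rw [row_append_singleton x.2, row_append_singleton (g x).2]
      split_ifs at * <;> omega
  · rintro ⟨hg, hfix⟩ x
    by_cases hx : a + b ≤ x
    · rw [hfix x hx]
    · have h := hg x
      rw [row_append_singleton x.2, row_append_singleton (g x).2] at h
      rw [row_cons_cons_replicate_one x.2, row_cons_cons_replicate_one (g x).2]
      split_ifs at * <;> omega

end Tableaux

/-! ### Tabloids and polytabloids -/

section Polytabloid

variable (k : Type*) [Field k] (d : ℕ) (lam : List ℕ)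

theorem permutationModule_apply_tabloid {g : Perm (Fin d)} (hg : g ∈ youngSubgroup d lam) :
    permutationModule k d lam g (tabloid k d lam) = tabloid k d lam :=
  ind_apply_mk_one (youngSubgroup d lam).subtype
    (Representation.trivial k (youngSubgroup d lam) k) ⟨g, hg⟩ 1

/-- The homomorphism from `M^λ` that sends the canonical generator to a vector fixed by the Young
subgroup. -/
noncomputable def permutationModuleLift {B : Type*} [AddCommGroup B] [Module k B]
    (σ : Representation k (Perm (Fin d)) B) (v : B) (hv : ∀ g ∈ youngSubgroup d lam, σ g v = v) :
    (permutationModule k d lam).IntertwiningMap σ :=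
  indLift _ _ σ (LinearMap.toSpanSingleton k B v) fun g x => by simp [hv g.1 g.2]

theorem permutationModuleLift_tabloid {B : Type*} [AddCommGroup B] [Module k B]
    (σ : Representation k (Perm (Fin d)) B) (v : B) (hv : ∀ g ∈ youngSubgroup d lam, σ g v = v) :
    permutationModuleLift k d lam σ v hv (tabloid k d lam) = v := by
  refine (indLift_mk _ _ σ _ _ 1 1).trans ?_
  simp

/-- Row and column stabilizers meet trivially, so the tabloid `{t}` occurs in the polytabloid only
for the identity, with coefficient 1. The coefficient is read off in the permutation module on the
cosets of the Young subgroup. -/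
theorem polytabloid_ne_zero : polytabloid k d lam ≠ 0 := by
  classical
  let H := youngSubgroup d lam
  let σ := Representation.ofMulAction k (Perm (Fin d)) (Perm (Fin d) ⧸ H)
  let f := permutationModuleLift k d lam σ (.single ((1 : Perm (Fin d)) : Perm (Fin d) ⧸ H) 1)
    fun g hg => by
      rw [Representation.ofMulAction_single]
      congr 1
      exact QuotientGroup.eq.2 (by simpa using H.inv_mem hg)
  let L : MonoidAlgebra k (Perm (Fin d) ⧸ H) →ₗ[k] k :=
    Finsupp.lapply ((1 : Perm (Fin d)) : Perm (Fin d) ⧸ H) ∘ₗ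
      (MonoidAlgebra.coeffLinearEquiv k).toLinearMap
  have hL (g : Perm (Fin d)) :
      L (f (permutationModule k d lam g (tabloid k d lam))) = if g ∈ H then 1 else 0 := by
    rw [f.isIntertwining, permutationModuleLift_tabloid, Representation.ofMulAction_single]
    have h1 : (g • ((1 : Perm (Fin d)) : Perm (Fin d) ⧸ H) = ((1 : Perm (Fin d)) : _ ⧸ H)) ↔
        g ∈ H := by
      rw [MulAction.Quotient.smul_coe, QuotientGroup.eq]
      simp
    simp only [← h1]
    simp [L, Finsupp.single_apply]
  have hone (g : columnStabilizer d lam) : g.1 ∈ H ↔ g = 1 := by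
    refine ⟨fun hg => Subtype.ext (Equiv.ext fun x => Fin.ext ?_), ?_⟩
    · exact eq_of_row_eq_of_col_eq lam (hg x) (g.2 x)
    · rintro rfl
      exact H.one_mem
  intro h0
  have h1 : L (f (polytabloid k d lam)) = 1 := by
    rw [polytabloid, map_sum, map_sum, Finset.sum_eq_single 1]
    · rw [map_smul, map_smul, hL, if_pos ((hone 1).2 rfl)]
      simp
    · intro g _ hg
      rw [map_smul, map_smul, hL, if_neg (mt (hone g).1 hg), smul_zero]
    · simp
  rw [h0, map_zero, map_zero] at h1
  exact zero_ne_one h1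

theorem polytabloid_mem_spechtModule : polytabloid k d lam ∈ spechtModule k d lam :=
  Submodule.subset_span ⟨1, by simp⟩

open scoped Classical in
/-- Multiplying the tableau by an element of its column stabilizer changes the polytabloid by the
sign. -/
theorem sum_columnStabilizer_apply_sign_smul {q : Perm (Fin d)}
    (hq : q ∈ columnStabilizer d lam) :
    ∑ g : columnStabilizer d lam, ((Perm.sign (g : Perm (Fin d)) : ℤ) : k) •
      permutationModule k d lam g (((Perm.sign q : ℤ) : k) •
        permutationModule k d lam q (tabloid k d lam)) = polytabloid k d lam := by
  -- Reindex by `g ↦ g q`; the signs multiply.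
  refine Fintype.sum_equiv (Equiv.mulRight (⟨q, hq⟩ : columnStabilizer d lam)) _ _ fun g => ?_
  rw [map_smul, smul_smul]
  simp [mul_comm]

end Polytabloid

/-! ### Generators of signed permutation modules -/

section SignedPermutationModule

variable (k : Type*) [Field k] (d : ℕ) (lam mu : List ℕ)

/-- The canonical generator `1 ⊗ 1` of `M^(λ|μ)`. -/
noncomputable def signedTabloid :
    Representation.IndV (youngSubgroup d (lam ++ mu)).subtype (trivialTensorSign k d lam mu) :=
  Representation.IndV.mk (youngSubgroup d (lam ++ mu)).subtype (trivialTensorSign k d lam mu) 1 1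

theorem signedPermutationModule_apply_signedTabloid (g : youngSubgroup d (lam ++ mu)) :
    signedPermutationModule k d lam mu g (signedTabloid k d lam mu) =
      ((signCharacter d lam mu g : ℤ) : k) • signedTabloid k d lam mu := by
  refine (ind_apply_mk_one (youngSubgroup d (lam ++ mu)).subtype
    (trivialTensorSign k d lam mu) g 1).trans ?_
  rw [signedTabloid, ← map_smul]
  rfl

/-- The homomorphism from `M^(λ|μ)` that sends the canonical generator to a vector on which
`Σ_λ × Σ_μ` acts by `k ⊠ sgn`. -/
noncomputable def signedPermutationModuleLift {B : Type*} [AddCommGroup B] [Module k B]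
    (σ : Representation k (Perm (Fin d)) B) (v : B)
    (hv : ∀ g : youngSubgroup d (lam ++ mu), σ g v = ((signCharacter d lam mu g : ℤ) : k) • v) :
    (signedPermutationModule k d lam mu).IntertwiningMap σ :=
  indLift _ _ σ (LinearMap.toSpanSingleton k B v) fun g x => by
    simp [hv g, trivialTensorSign, smul_smul, mul_comm]

theorem signedPermutationModuleLift_signedTabloid {B : Type*} [AddCommGroup B] [Module k B]
    (σ : Representation k (Perm (Fin d)) B) (v : B)
    (hv : ∀ g : youngSubgroup d (lam ++ mu), σ g v = ((signCharacter d lam mu g : ℤ) : k) • v) :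
    signedPermutationModuleLift k d lam mu σ v hv (signedTabloid k d lam mu) = v := by
  refine (indLift_mk _ _ σ _ _ 1 1).trans ?_
  simp

end SignedPermutationModule

/-! ### The two homomorphisms and their composite on the polytabloid -/

section Hook

variable (k : Type*) [Field k] (a b c : ℕ)

/-- The letters of the last part of the composition `(a, b, c)`. -/
abbrev LastLetters (a b c : ℕ) :=
  {x : Fin (a + b + c) // [a, b].length ≤ row ([a, b] ++ [c]) x}

theorem length_le_row_iff (x : Fin (a + b + c)) :
    [a, b].length ≤ row ([a, b] ++ [c]) x ↔ a + b ≤ x :=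
  two_le_row_append_singleton x.2

theorem card_lastLetters : Fintype.card (LastLetters a b c) = c := by
  let e : LastLetters a b c ≃ Fin c :=
    { toFun x := ⟨x.1 - (a + b), by
        have := (length_le_row_iff a b c x.1).1 x.2
        omega⟩
      invFun y := ⟨⟨y + (a + b), by omega⟩, (length_le_row_iff a b c _).2 (by simp)⟩
      left_inv x := by
        have := (length_le_row_iff a b c x.1).1 x.2
        ext
        simp
        omega
      right_inv y := by
        ext
        simp }
  simpa using Fintype.card_congr e

variable {a b c}

/-- The last `c` letters all lie in column `0`; this lets the polytabloid absorb their permutations.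
-/
theorem ofSubtype_mem_columnStabilizer (τ : Perm (LastLetters a b c)) :
    Perm.ofSubtype τ ∈ columnStabilizer (a + b + c) (a :: b :: List.replicate c 1) := by
  intro x
  by_cases hx : [a, b].length ≤ row ([a, b] ++ [c]) x
  · rw [Perm.ofSubtype_apply_of_mem τ hx,
      col_cons_cons_replicate_one (x.2) ((length_le_row_iff a b c x).1 hx),
      col_cons_cons_replicate_one (τ ⟨x, hx⟩).1.2
        ((length_le_row_iff a b c _).1 (τ ⟨x, hx⟩).2)]
  · rw [Perm.ofSubtype_apply_of_not_mem τ hx]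

theorem ofSubtype_mem_youngSubgroup (τ : Perm (LastLetters a b c)) :
    Perm.ofSubtype τ ∈ youngSubgroup (a + b + c) ([a, b] ++ [c]) := by
  intro x
  by_cases hx : [a, b].length ≤ row ([a, b] ++ [c]) x
  · have h1 := (length_le_row_iff a b c x).1 hx
    have h2 := (length_le_row_iff a b c _).1 (τ ⟨x, hx⟩).2
    rw [Perm.ofSubtype_apply_of_mem τ hx, row_append_singleton x.2,
      row_append_singleton (τ ⟨x, hx⟩).1.2]
    split_ifs <;> omega
  · rw [Perm.ofSubtype_apply_of_not_mem τ hx]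

/-- The permutation of the last letters that is induced by an element of the Young subgroup. -/
def restrictLastLetters (g : youngSubgroup (a + b + c) ([a, b] ++ [c])) :
    Perm (LastLetters a b c) :=
  Perm.subtypePerm g.1 fun x => by rw [g.2 x]

theorem signCharacter_eq_sign_restrictLastLetters
    (g : youngSubgroup (a + b + c) ([a, b] ++ [c])) :
    signCharacter (a + b + c) [a, b] [c] g = Perm.sign (restrictLastLetters g) := rfl

theorem restrictLastLetters_eq_one {g : Perm (Fin (a + b + c))}
    (hg : g ∈ youngSubgroup (a + b + c) (a :: b :: List.replicate c 1)) :
    restrictLastLetters ⟨g, (mem_youngSubgroup_cons_cons_replicate_one.1 hg).1⟩ = 1 := by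
  ext x
  exact congrArg Fin.val ((mem_youngSubgroup_cons_cons_replicate_one.1 hg).2 x.1
    ((length_le_row_iff a b c x.1).1 x.2))

/-- An element of `Σ_a × Σ_b × Σ_c` maps a coset `τ Σ_(a,b,1^c)` with `τ ∈ Σ_c` to the coset
of the product of its component in `Σ_c` with `τ`. -/
theorem inv_mul_mul_ofSubtype_mem (g : youngSubgroup (a + b + c) ([a, b] ++ [c]))
    (τ : Perm (LastLetters a b c)) :
    (Perm.ofSubtype (restrictLastLetters g * τ))⁻¹ * (g.1 * Perm.ofSubtype τ) ∈
      youngSubgroup (a + b + c) (a :: b :: List.replicate c 1) := by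
  refine mem_youngSubgroup_cons_cons_replicate_one.2 ⟨mul_mem (inv_mem
    (ofSubtype_mem_youngSubgroup _)) (mul_mem g.2 (ofSubtype_mem_youngSubgroup τ)), fun x hx => ?_⟩
  have hx' := (length_le_row_iff a b c x).2 hx
  rw [Perm.mul_apply, Perm.inv_eq_iff_eq, Perm.mul_apply, Perm.ofSubtype_apply_of_mem (a := x) _ hx',
    Perm.ofSubtype_apply_of_mem (a := x) _ hx']
  rfl

variable (a b c)

/-- The signed sum `∑ sgn(τ) τ • {t}` over the permutations `τ` of the last `c` letters. -/
noncomputable def alternatingTabloid :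
    PermutationModule k (a + b + c) (a :: b :: List.replicate c 1) :=
  ∑ τ : Perm (LastLetters a b c), ((Perm.sign τ : ℤ) : k) •
    permutationModule k (a + b + c) (a :: b :: List.replicate c 1) (Perm.ofSubtype τ)
      (tabloid k (a + b + c) (a :: b :: List.replicate c 1))

/-- Left multiplication by the `Σ_c` component of `g` reindexes the sum, at the cost of its sign;
the remaining factor of `g` fixes the tabloid. This is the condition for mapping out of `M^(a,b|c)`.
-/
theorem permutationModule_apply_alternatingTabloid
    (g : youngSubgroup (a + b + c) ([a, b] ++ [c])) :
    permutationModule k (a + b + c) (a :: b :: List.replicate c 1) g (alternatingTabloid k a b c) =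
      ((signCharacter (a + b + c) [a, b] [c] g : ℤ) : k) • alternatingTabloid k a b c := by
  rw [alternatingTabloid, map_sum, Finset.smul_sum]
  refine Fintype.sum_equiv (Equiv.mulLeft (restrictLastLetters g)) _ _ fun τ => ?_
  have h := permutationModule_apply_tabloid k _ _ (inv_mul_mul_ofSubtype_mem g τ)
  have h2 : permutationModule k (a + b + c) (a :: b :: List.replicate c 1) g.1
      (permutationModule k _ _ (Perm.ofSubtype τ) (tabloid k _ _)) =
      permutationModule k _ _ (Perm.ofSubtype (restrictLastLetters g * τ)) (tabloid k _ _) := by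
    conv_rhs => rw [← h]
    rw [← Module.End.mul_apply, ← Module.End.mul_apply, ← map_mul, ← map_mul, mul_inv_cancel_left]
  rw [map_smul, h2, Equiv.coe_mulLeft, smul_smul, signCharacter_eq_sign_restrictLastLetters]
  congr 1
  rw [Perm.sign_mul, ← Int.cast_mul, ← Units.val_mul, ← mul_assoc, Int.units_mul_self, one_mul]

/-- The homomorphism `M^(a,b,1^c) → M^(a,b|c)` between the canonical generators. -/
noncomputable def toSignedPermutationModule :
    (permutationModule k (a + b + c) (a :: b :: List.replicate c 1)).IntertwiningMap
      (signedPermutationModule k (a + b + c) [a, b] [c]) :=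
  permutationModuleLift k _ _ _ (signedTabloid k _ _ _) fun g hg => by
    have hg' := (mem_youngSubgroup_cons_cons_replicate_one.1 hg).1
    refine (signedPermutationModule_apply_signedTabloid k (a + b + c) [a, b] [c] ⟨g, hg'⟩).trans ?_
    -- Elements of `Σ_(a,b,1^c)` fix the last letters, so the sign character is trivial on them.
    rw [signCharacter_eq_sign_restrictLastLetters, restrictLastLetters_eq_one hg]
    simp

/-- The homomorphism `M^(a,b|c) → M^(a,b,1^c)` that antisymmetrizes the last `c` letters. -/
noncomputable def ofSignedPermutationModule :
    (signedPermutationModule k (a + b + c) [a, b] [c]).IntertwiningMap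
      (permutationModule k (a + b + c) (a :: b :: List.replicate c 1)) :=
  signedPermutationModuleLift k _ _ _ _ (alternatingTabloid k a b c)
    (permutationModule_apply_alternatingTabloid k a b c)

theorem ofSigned_toSigned_polytabloid :
    ofSignedPermutationModule k a b c (toSignedPermutationModule k a b c
      (polytabloid k (a + b + c) (a :: b :: List.replicate c 1))) =
      (c.factorial : k) • polytabloid k (a + b + c) (a :: b :: List.replicate c 1) := by
  classical
  have h1 (g : Perm (Fin (a + b + c))) : ofSignedPermutationModule k a b c
      (toSignedPermutationModule k a b c
        (permutationModule k (a + b + c) (a :: b :: List.replicate c 1) g (tabloid k _ _))) =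
      permutationModule k (a + b + c) (a :: b :: List.replicate c 1) g
        (alternatingTabloid k a b c) := by
    rw [(toSignedPermutationModule k a b c).isIntertwining,
      (ofSignedPermutationModule k a b c).isIntertwining]
    congr 1
    rw [toSignedPermutationModule, permutationModuleLift_tabloid]
    exact signedPermutationModuleLift_signedTabloid k _ _ _ _ _ _
  have h2 (τ : Perm (LastLetters a b c)) :=
    sum_columnStabilizer_apply_sign_smul k _ _ (ofSubtype_mem_columnStabilizer τ)
  simp only [Perm.sign_ofSubtype] at h2
  conv_lhs => rw [polytabloid]
  simp only [map_sum, map_smul, h1, alternatingTabloid, Finset.smul_sum]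
  -- With the sum over `τ` outermost, each of the `c!` inner sums is the polytabloid itself.
  rw [Finset.sum_comm]
  simp only [map_smul] at h2
  refine (Finset.sum_congr rfl fun τ _ => h2 τ).trans ?_
  rw [Finset.sum_const, Finset.card_univ, Fintype.card_perm, card_lastLetters, Nat.cast_smul_eq_nsmul]

end Hook

end SignedYoung

theorem proposition3p5p1 {k : Type*} [Field k] [IsAlgClosed k] (p : ℕ) [CharP k p]
    (a b c : ℕ) (hb : 1 ≤ b) (hba : b ≤ a) (hc : 1 ≤ c) (hcp : c < p)
    {V : Type*} [AddCommGroup V] [Module k V]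
    (Y : Representation k (Equiv.Perm (Fin (a + b + c))) V)
    (hY : SignedYoung.IsYoungModule (a :: b :: List.replicate c 1) Y) :
    SignedYoung.IsDirectSummand Y
        (SignedYoung.signedPermutationModule k (a + b + c) [a, b] [c]) ∧
      SignedYoung.IsSignedYoungModule 2 1 Y := by
  obtain ⟨hind, U, U', hU, hS, ⟨e⟩⟩ := hY
  -- `c < p` excludes `p = 0`; a prime divides `c!` only if it is at most `c`.
  have hp : p.Prime := (CharP.char_is_prime_or_zero k p).resolve_right (by omega)
  have hfac : (c.factorial : k) ≠ 0 := by
    rw [Ne, CharP.cast_eq_zero_iff k p, hp.dvd_factorial]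
    omega
  have hsummand := SignedYoung.isDirectSummand_of_eigenvector hind hU e
    (SignedYoung.toSignedPermutationModule k a b c)
    (SignedYoung.ofSignedPermutationModule k a b c)
    (hS (SignedYoung.polytabloid_mem_spechtModule k _ _))
    (SignedYoung.polytabloid_ne_zero k _ _) hfac
    (SignedYoung.ofSigned_toSigned_polytabloid k a b c)
  exact ⟨hsummand, ([a, b], [c]), ⟨rfl, rfl, by simp⟩, hsummand⟩
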